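/- **Definitions.** $C_{l,Lip}(\mathbb{R}^n)$ is the set of functions $\varphi:\mathbb{R}^n\to\mathbb{R}$ such that $|\varphi(x)-\varphi(y)|\le C(1+|x|^m+|y|^m)|x-y|$ for all $x,y$, for some $C>0$ and $m\in\mathbb{N}$. A *sublinear expectation space* $(\Omega,\mathcal{H},\mathbb{E})$ consists of a measurable space $\Omega$, a set $\mathcal{H}$ of real random variables on $\Omega$ containing the constants and such that $\varphi(Z_1,\dots,Z_n)\in\mathcal{H}$ whenever $Z_1,\dots,Z_n\in\mathcal{H}$ and $\varphi\in C_{l,Lip}(\mathbb{R}^n)$, and a functional $\mathbb{E}:\mathcal{H}\to\mathbb{R}$ that is monotone, constant preserving, sub-additive and positively homogeneous. A $d$-dimensional random vector is a map $\Omega\to\mathbb{R}^d$ with all coordinates in $\mathcal{H}$. Two $d$-dimensional random vectors $X,X'$, possibly on different sublinear expectation spaces with expectations $\mathbb{E},\mathbb{E}'$, are *identically distributed* if $\mathbb{E}[\varphi(X)]=\mathbb{E}'[\varphi(X')]$ for all $\varphi\in C_{l,Lip}(\mathbb{R}^d)$. A sequence $(X_i)_{i\ge1}$ of $d$-dimensional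 random vectors is *convolutionary* if for all $1\le k\le n$ and all $\varphi\in C_{l,Lip}(\mathbb{R}^d)$, writing $S_{k,n}=\sum_{i=k}^nX_i$, $$\mathbb{E}[\varphi(S_{k,n}+X_{n+1})]=\mathbb{E}\big[\mathbb{E}[\varphi(x+X_{n+1})]_{x=S_{k,n}}\big].$$ A $d$-dimensional random vector $\eta$ on a sublinear expectation space $(\Omega',\mathcal{H}',\mathbb{E}')$ is *maximally distributed* if there is a bounded, closed, convex $\Gamma\subset\mathbb{R}^d$ such that $\mathbb{E}'[\varphi(\eta)]=\max_{x\in\Gamma}\varphi(x)$ for all $\varphi\in C_{l,Lip}(\mathbb{R}^d)$; it is *characterized by* $G:\mathbb{R}^d\to\mathbb{R}$ if $\mathbb{E}'[\langle p,\eta\rangle]=G(p)$ for all $p\in\mathbb{R}^d$. A function $f:\Omega\to\mathbb{R}$ *belongs to the completion* of $\mathcal{H}$ if for every $\varepsilon>0$ there are $g,h\in\mathcal{H}$ with $|f-g|\le h$ and $\mathbb{E}[h]\le\varepsilon$; then $\mathbb{E}[f]:=\inf\{\mathbb{E}[g]:g\in\mathcal{H},\,g\ge f\}$, which is the unique value with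 $|\mathbb{E}[f]-\mathbb{E}[g]|\le\mathbb{E}[h]$ for all such $g,h$, and is the given value if $f\in\mathcal{H}$. **Theorem (weak law of large numbers).** Let $(X_i)_{i\ge1}$ be a convolutionary sequence of identically distributed $d$-dimensional random vectors on a sublinear expectation space $(\Omega,\mathcal{H},\mathbb{E})$ (so that $\mathbb{E}[|X_1|^2]<\infty$, since $|X_1|^2\in\mathcal{H}$ and $\mathbb{E}$ is real-valued). Put $S_n=\sum_{i=1}^nX_i$ and $G(p)=\mathbb{E}[\langle p,X_1\rangle]$ for $p\in\mathbb{R}^d$. Then there is a maximally distributed random vector, on a suitable sublinear expectation space over $\mathbb{R}^d$, characterized by $G$. Moreover, for every maximally distributed random vector $\eta$ characterized by $G$, on an arbitrary sublinear expectation space $(\Omega',\mathcal{H}',\mathbb{E}')$, and every continuous $\varphi:\mathbb{R}^d\to\mathbb{R}$ with $|\varphi(x)|\le C(1+|x|)$ for some $C$ and all $x$, the functions $\varphi(S_n/n)$ and $\varphi(\eta)$ belong to the completions of $\mathcal{H}$ and $\mathcal{H}'$ respectively, and $$\lim_{n\to\infty}\mathbb{E}\Big[\varphi\Big(\frac{S_n}{n}\Big)\Big]=\mathbb{E}'[\varphi(\eta)].$$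 -/

import Mathlib

open Filter Topology

universe u v

/-- `C_{l,Lip}(V)`: the functions `φ` with
`|φ x - φ y| ≤ C (1 + |x|^m + |y|^m) |x - y|` for some `C > 0` and `m ∈ ℕ`. -/
def LocLip {V : Type*} [NormedAddCommGroup V] (φ : V → ℝ) : Prop :=
  ∃ C : ℝ, 0 < C ∧ ∃ m : ℕ, ∀ x y : V,
    |φ x - φ y| ≤ C * (1 + ‖x‖ ^ m + ‖y‖ ^ m) * ‖x - y‖

/-- A sublinear expectation space `(Ω, H, E)` over a measurable space `Ω`.
`H` is a set of random variables that is stable under `C_{l,Lip}` functions of finitely many of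
its elements (the case `n = 0` says that constants are in `H`). `E` is a real-valued functional
on `H`; it is represented by a total function of which only the values on `H` matter. -/
structure SublinearExpectation (Ω : Type u) [MeasurableSpace Ω] where
  H : Set (Ω → ℝ)
  E : (Ω → ℝ) → ℝ
  measurable_of_mem : ∀ X ∈ H, Measurable X
  comp_mem : ∀ (n : ℕ) (X : Fin n → Ω → ℝ), (∀ i, X i ∈ H) →
    ∀ φ : EuclideanSpace ℝ (Fin n) → ℝ, LocLip φ →
      (fun ω => φ (WithLp.toLp 2 (fun i => X i ω))) ∈ H
  mono : ∀ X ∈ H, ∀ Y ∈ H, (∀ ω, Y ω ≤ X ω) → E Y ≤ E X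
  const : ∀ c : ℝ, E (fun _ => c) = c
  subadd : ∀ X ∈ H, ∀ Y ∈ H, E (fun ω => X ω + Y ω) ≤ E X + E Y
  posHom : ∀ c : ℝ, 0 ≤ c → ∀ X ∈ H, E (fun ω => c * X ω) = c * E X

/-- A `d`-dimensional random vector: all coordinates belong to `H`. -/
def SublinearExpectation.IsRandomVector {Ω : Type u} [MeasurableSpace Ω]
    (S : SublinearExpectation Ω) {d : ℕ} (X : Ω → EuclideanSpace ℝ (Fin d)) : Prop :=
  ∀ i : Fin d, (fun ω => X ω i) ∈ S.H

/-- `X₁` on `(Ω₁, H₁, E₁)` and `X₂` on `(Ω₂, H₂, E₂)` are identically distributed. -/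
def IdentDistributed {Ω₁ : Type u} [MeasurableSpace Ω₁] {Ω₂ : Type v} [MeasurableSpace Ω₂]
    (S₁ : SublinearExpectation Ω₁) (S₂ : SublinearExpectation Ω₂) {d : ℕ}
    (X₁ : Ω₁ → EuclideanSpace ℝ (Fin d)) (X₂ : Ω₂ → EuclideanSpace ℝ (Fin d)) : Prop :=
  ∀ φ : EuclideanSpace ℝ (Fin d) → ℝ, LocLip φ →
    S₁.E (fun ω => φ (X₁ ω)) = S₂.E (fun ω => φ (X₂ ω))

/-- `Y` and `X` are of convolution: `E[φ(X + Y)] = E[E[φ(x + Y)]_{x = X}]`. -/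
def SublinearExpectation.IsConvolution {Ω : Type u} [MeasurableSpace Ω]
    (S : SublinearExpectation Ω) {d : ℕ} (Y X : Ω → EuclideanSpace ℝ (Fin d)) : Prop :=
  ∀ φ : EuclideanSpace ℝ (Fin d) → ℝ, LocLip φ →
    S.E (fun ω => φ (X ω + Y ω)) = S.E (fun ω => S.E (fun ω' => φ (X ω + Y ω')))

/-- A convolutionary sequence, indexed from `0`: for all `k ≤ n`, the vectors `X (n + 1)` and
`X k + ⋯ + X n` are of convolution, i.e.
`E[φ(X k + ⋯ + X (n + 1))] = E[E[φ(x + X (n + 1))]_{x = X k + ⋯ + X n}]`. -/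
def SublinearExpectation.IsConvolutionary {Ω : Type u} [MeasurableSpace Ω]
    (S : SublinearExpectation Ω) {d : ℕ} (X : ℕ → Ω → EuclideanSpace ℝ (Fin d)) : Prop :=
  ∀ n k : ℕ, k ≤ n →
    S.IsConvolution (X (n + 1)) (fun ω => ∑ i ∈ Finset.Icc k n, X i ω)

/-- `η` is maximally distributed: for some bounded, closed and convex `Γ ⊆ ℝ^d`, for every
`φ ∈ C_{l,Lip}(ℝ^d)`, the maximum of `φ` over `Γ` exists and equals `E[φ(η)]`. -/
def SublinearExpectation.IsMaximal {Ω : Type u} [MeasurableSpace Ω]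
    (S : SublinearExpectation Ω) {d : ℕ} (η : Ω → EuclideanSpace ℝ (Fin d)) : Prop :=
  ∃ Γ : Set (EuclideanSpace ℝ (Fin d)), Bornology.IsBounded Γ ∧ IsClosed Γ ∧ Convex ℝ Γ ∧
    ∀ φ : EuclideanSpace ℝ (Fin d) → ℝ, LocLip φ →
      IsGreatest (φ '' Γ) (S.E (fun ω => φ (η ω)))

/-- `f` belongs to the completion of `H` with respect to `E[|·|]`: for every `ε > 0` there are
`g, h ∈ H` with `|f - g| ≤ h` and `E[h] ≤ ε`. -/
def SublinearExpectation.InCompletion {Ω : Type u} [MeasurableSpace Ω]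
    (S : SublinearExpectation Ω) (f : Ω → ℝ) : Prop :=
  ∀ ε : ℝ, 0 < ε → ∃ g ∈ S.H, ∃ h ∈ S.H, (∀ ω, |f ω - g ω| ≤ h ω) ∧ S.E h ≤ ε

/-- The extension of `E` from `H` to its completion, written as an upper expectation. It agrees
with `E` on `H` (`expect_of_mem`), and on the completion it is the limit of `E[g]` along every
approximation of `f` by elements `g` of `H` (`abs_expect_sub_le`). -/
noncomputable def SublinearExpectation.expect {Ω : Type u} [MeasurableSpace Ω]
    (S : SublinearExpectation Ω) (f : Ω → ℝ) : ℝ :=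
  sInf {a : ℝ | ∃ g ∈ S.H, (∀ ω, f ω ≤ g ω) ∧ a = S.E g}

section Facts

variable {Ω : Type u} [MeasurableSpace Ω] (S : SublinearExpectation Ω)

theorem SublinearExpectation.comp_vec_mem {d : ℕ} {X : Ω → EuclideanSpace ℝ (Fin d)}
    (hX : S.IsRandomVector X) {φ : EuclideanSpace ℝ (Fin d) → ℝ} (hφ : LocLip φ) :
    (fun ω => φ (X ω)) ∈ S.H :=
  S.comp_mem d (fun i ω => X ω i) hX φ hφ

theorem SublinearExpectation.const_mem (c : ℝ) : (fun _ : Ω => c) ∈ S.H :=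
  S.comp_mem 0 (fun i => i.elim0) (fun i => i.elim0) (fun _ => c)
    ⟨1, one_pos, 0, fun x y => by simp; positivity⟩

theorem SublinearExpectation.add_mem {f g : Ω → ℝ} (hf : f ∈ S.H) (hg : g ∈ S.H) :
    (fun ω => f ω + g ω) ∈ S.H := by
  have h := S.comp_mem 2 ![f, g] (by intro i; fin_cases i <;> simpa)
    (fun x => x 0 + x 1) ⟨2, two_pos, 0, fun x y => by
      have h0 : |x 0 - y 0| ≤ ‖x - y‖ := by
        simpa using PiLp.norm_apply_le (x - y) 0
      have h1 : |x 1 - y 1| ≤ ‖x - y‖ := by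
        simpa using PiLp.norm_apply_le (x - y) 1
      have h2 : x 0 + x 1 - (y 0 + y 1) = (x 0 - y 0) + (x 1 - y 1) := by ring
      have h3 := abs_add_le (x 0 - y 0) (x 1 - y 1)
      have h4 := norm_nonneg (x - y)
      rw [h2]
      simp only [pow_zero]
      linarith⟩
  simpa using h

theorem SublinearExpectation.smul_mem (c : ℝ) {f : Ω → ℝ} (hf : f ∈ S.H) :
    (fun ω => c * f ω) ∈ S.H := by
  have h := S.comp_mem 1 ![f] (by intro i; fin_cases i; simpa)
    (fun x => c * x 0) ⟨|c| + 1, by positivity, 0, fun x y => by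
      have h0 : |x 0 - y 0| ≤ ‖x - y‖ := by
        simpa using PiLp.norm_apply_le (x - y) 0
      have h4 := norm_nonneg (x - y)
      have h5 : |c| * |x 0 - y 0| ≤ |c| * ‖x - y‖ := by gcongr
      have h6 : 0 ≤ |c| * ‖x - y‖ := by positivity
      rw [← mul_sub, abs_mul]
      simp only [pow_zero]
      nlinarith⟩
  simpa using h

theorem SublinearExpectation.expect_of_mem {f : Ω → ℝ} (hf : f ∈ S.H) :
    S.expect f = S.E f := by
  refine IsLeast.csInf_eq ⟨⟨f, hf, fun _ => le_rfl, rfl⟩, ?_⟩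
  rintro a ⟨g, hg, hfg, rfl⟩
  exact S.mono g hg f hf hfg

theorem SublinearExpectation.abs_expect_sub_le {f g h : Ω → ℝ}
    (hg : g ∈ S.H) (hh : h ∈ S.H) (hfg : ∀ ω, |f ω - g ω| ≤ h ω) :
    |S.expect f - S.E g| ≤ S.E h := by
  have hlow : ∀ a ∈ {a : ℝ | ∃ k ∈ S.H, (∀ ω, f ω ≤ k ω) ∧ a = S.E k}, S.E g - S.E h ≤ a := by
    rintro a ⟨k, hk, hfk, rfl⟩
    have h1 := S.mono _ (S.add_mem hk hh) g hg (fun ω => by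
      have := (abs_le.mp (hfg ω)).1
      have := hfk ω
      linarith)
    have h2 := S.subadd k hk h hh
    linarith
  have hmem : S.E (fun ω => g ω + h ω) ∈
      {a : ℝ | ∃ k ∈ S.H, (∀ ω, f ω ≤ k ω) ∧ a = S.E k} :=
    ⟨_, S.add_mem hg hh, fun ω => by
      have := (abs_le.mp (hfg ω)).2
      linarith, rfl⟩
  have h1 : S.E g - S.E h ≤ S.expect f := le_csInf ⟨_, hmem⟩ hlow
  have h2 : S.expect f ≤ S.E (fun ω => g ω + h ω) := csInf_le ⟨_, hlow⟩ hmem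
  have h3 := S.subadd g hg h hh
  rw [abs_le]
  constructor <;> linarith

theorem LocLip.norm_pow {V : Type*} [NormedAddCommGroup V] (m : ℕ) :
    LocLip (fun x : V => ‖x‖ ^ m) := by
  refine ⟨m + 1, by positivity, m - 1, fun x y => ?_⟩
  have h1 : |‖x‖ - ‖y‖| ≤ ‖x - y‖ := abs_norm_sub_norm_le x y
  have h2 := abs_pow_sub_pow_le ‖x‖ ‖y‖ m
  simp only [abs_norm] at h2
  have h3 : max ‖x‖ ‖y‖ ^ (m - 1) ≤ 1 + ‖x‖ ^ (m - 1) + ‖y‖ ^ (m - 1) := by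
    have hx : 0 ≤ ‖x‖ ^ (m - 1) := by positivity
    have hy : 0 ≤ ‖y‖ ^ (m - 1) := by positivity
    rcases max_choice ‖x‖ ‖y‖ with h | h <;> rw [h] <;> linarith
  calc |‖x‖ ^ m - ‖y‖ ^ m| ≤ |‖x‖ - ‖y‖| * m * max ‖x‖ ‖y‖ ^ (m - 1) := h2
    _ ≤ ‖x - y‖ * (m + 1) * (1 + ‖x‖ ^ (m - 1) + ‖y‖ ^ (m - 1)) := by
        gcongr
        linarith
    _ = _ := by ring

/-- The second moment of a random vector is the (real, hence finite) expectation of an element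
of `H`. -/
theorem SublinearExpectation.norm_sq_mem {d : ℕ} {X : Ω → EuclideanSpace ℝ (Fin d)}
    (hX : S.IsRandomVector X) : (fun ω => ‖X ω‖ ^ 2) ∈ S.H :=
  S.comp_vec_mem hX (LocLip.norm_pow 2)

theorem LocLip.comp_add {V : Type*} [NormedAddCommGroup V] {φ : V → ℝ} (hφ : LocLip φ) (x : V) :
    LocLip (fun y => φ (x + y)) := by
  obtain ⟨C, hC, m, h⟩ := hφ
  refine ⟨C * (1 + 2 ^ (m + 1) * ‖x‖ ^ m + 2 ^ m), by positivity, m, fun y z => ?_⟩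
  have key : ∀ y : V, ‖x + y‖ ^ m ≤ 2 ^ m * (‖x‖ ^ m + ‖y‖ ^ m) := fun y => by
    calc ‖x + y‖ ^ m ≤ (‖x‖ + ‖y‖) ^ m := by gcongr; exact norm_add_le x y
      _ ≤ 2 ^ (m - 1) * (‖x‖ ^ m + ‖y‖ ^ m) :=
        add_pow_le (norm_nonneg x) (norm_nonneg y) m
      _ ≤ 2 ^ m * (‖x‖ ^ m + ‖y‖ ^ m) := by gcongr <;> simp
  have h1 := h (x + y) (x + z)
  rw [add_sub_add_left_eq_sub] at h1
  refine h1.trans ?_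
  rw [mul_assoc C, mul_assoc C, mul_assoc C]
  refine mul_le_mul_of_nonneg_left ?_ hC.le
  refine mul_le_mul_of_nonneg_right ?_ (norm_nonneg _)
  have hy := key y
  have hz := key z
  have a : 0 ≤ ‖x‖ ^ m := by positivity
  have b : 0 ≤ ‖y‖ ^ m := by positivity
  have c : 0 ≤ ‖z‖ ^ m := by positivity
  have e : (0 : ℝ) ≤ 2 ^ m := by positivity
  rw [pow_succ]
  nlinarith [mul_nonneg a b, mul_nonneg a c, mul_nonneg e (mul_nonneg a b),
    mul_nonneg e (mul_nonneg a c)]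

/-- The inner expectation in the definition of convolution is a `C_{l,Lip}` function of `x`, so
that the outer one is again the expectation of an element of `H`. -/
theorem SublinearExpectation.locLip_inner {d : ℕ} {Y : Ω → EuclideanSpace ℝ (Fin d)}
    (hY : S.IsRandomVector Y) {φ : EuclideanSpace ℝ (Fin d) → ℝ} (hφ : LocLip φ) :
    LocLip (fun x => S.E (fun ω => φ (x + Y ω))) := by
  have hmem : ∀ x, (fun ω => φ (x + Y ω)) ∈ S.H := fun x => S.comp_vec_mem hY (hφ.comp_add x)
  obtain ⟨C, hC, m, h⟩ := hφ
  have hM : (fun ω => ‖Y ω‖ ^ m) ∈ S.H := S.comp_vec_mem hY (LocLip.norm_pow m)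
  set M := S.E (fun ω => ‖Y ω‖ ^ m) with hMdef
  have hM0 : 0 ≤ M := by
    have := S.mono _ hM _ (S.const_mem 0) (fun ω => by positivity)
    rwa [S.const] at this
  have key : ∀ x y : EuclideanSpace ℝ (Fin d), ‖x + y‖ ^ m ≤ 2 ^ m * (‖x‖ ^ m + ‖y‖ ^ m) :=
    fun x y => by
    calc ‖x + y‖ ^ m ≤ (‖x‖ + ‖y‖) ^ m := by gcongr; exact norm_add_le x y
      _ ≤ 2 ^ (m - 1) * (‖x‖ ^ m + ‖y‖ ^ m) :=
        add_pow_le (norm_nonneg x) (norm_nonneg y) m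
      _ ≤ 2 ^ m * (‖x‖ ^ m + ‖y‖ ^ m) := by gcongr <;> simp
  have one : ∀ x y, S.E (fun ω => φ (x + Y ω)) ≤ S.E (fun ω => φ (y + Y ω)) +
      (C * (1 + 2 ^ m * (‖x‖ ^ m + ‖y‖ ^ m)) * ‖x - y‖ + C * 2 ^ (m + 1) * ‖x - y‖ * M) := by
    intro x y
    set a := C * (1 + 2 ^ m * (‖x‖ ^ m + ‖y‖ ^ m)) * ‖x - y‖
    set b := C * 2 ^ (m + 1) * ‖x - y‖
    have hb : 0 ≤ b := by positivity
    have hbM := S.smul_mem b hM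
    have hR := S.add_mem (S.const_mem a) hbM
    have h1 := S.mono _ (S.add_mem (hmem y) hR) _ (hmem x) (fun ω => by
      have h2 := h (x + Y ω) (y + Y ω)
      rw [add_sub_add_right_eq_sub] at h2
      have h3 : C * (1 + ‖x + Y ω‖ ^ m + ‖y + Y ω‖ ^ m) * ‖x - y‖ ≤
          C * (1 + 2 ^ m * (‖x‖ ^ m + ‖Y ω‖ ^ m) + 2 ^ m * (‖y‖ ^ m + ‖Y ω‖ ^ m)) * ‖x - y‖ := by
        gcongr
        · exact key x (Y ω)
        · exact key y (Y ω)
      have h4 : C * (1 + 2 ^ m * (‖x‖ ^ m + ‖Y ω‖ ^ m) + 2 ^ m * (‖y‖ ^ m + ‖Y ω‖ ^ m)) * ‖x - y‖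
          = a + b * ‖Y ω‖ ^ m := by
        simp only [a, b]; ring
      have h5 := (abs_le.mp h2).2
      linarith)
    have h2 := S.subadd _ (hmem y) _ hR
    have h3 := S.subadd _ (S.const_mem a) _ hbM
    rw [S.const, S.posHom b hb _ hM] at h3
    linarith
  refine ⟨C * (1 + 2 ^ (m + 1) * M + 2 ^ m), by positivity, m, fun x y => ?_⟩
  have hxy := one x y
  have hyx := one y x
  rw [norm_sub_rev y x, add_comm (‖y‖ ^ m)] at hyx
  have hle : C * (1 + 2 ^ m * (‖x‖ ^ m + ‖y‖ ^ m)) * ‖x - y‖ + C * 2 ^ (m + 1) * ‖x - y‖ * M ≤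
      C * (1 + 2 ^ (m + 1) * M + 2 ^ m) * (1 + ‖x‖ ^ m + ‖y‖ ^ m) * ‖x - y‖ := by
    have h0 : 0 ≤ C * ‖x - y‖ := by positivity
    have h1 : 0 ≤ (2 ^ (m + 1) * M + 1) * (‖x‖ ^ m + ‖y‖ ^ m) + 2 ^ m := by positivity
    nlinarith [mul_nonneg h0 h1]
  rw [abs_le]
  constructor <;> linarith

end Facts

/-!
Let `Γ` be the set of vectors `v` with `⟨p, v⟩ ≤ E[⟨p, X₀⟩]` for all `p`. By Hahn–Banach the support
function of `Γ` is exactly `p ↦ E[⟨p, X₀⟩]`, so `Γ` is the set over which any maximal distribution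
characterized by this function takes its maximum.

If `z` is the point of `n • Γ` nearest to `x` and `v ∈ Γ` is extremal in the direction `x - z`, then
`‖(x - z) + (X₀ - v)‖²` has expectation at most `‖x - z‖² + 4 E[‖X₀‖²]`, because the cross term has
nonpositive expectation. By the convolution property, the expected squared distance from `Sₙ` to
`n • Γ` is therefore at most `4 n E[‖X₀‖²]`. Dually, for every fixed `v ∈ Γ` the expectation of
`-‖Sₙ - n • v‖²` is at least `-4 n E[‖X₀‖²]`. Hence `E[g(Sₙ / n)]` differs from `max_Γ g` by
`O(n^{-1/2})` for Lipschitz `g`. By Jensen's inequality all moments of `Sₙ / n` are bounded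
uniformly in `n`, and a continuous function of polynomial growth is a limit of Lipschitz functions,
uniformly with respect to the weight `1 + ‖x‖ ^ q` for large `q`.
-/

open Asymptotics

theorem LocLip.neg {V : Type*} [NormedAddCommGroup V] {φ : V → ℝ} (hφ : LocLip φ) :
    LocLip (fun x => -φ x) := by
  obtain ⟨C, hC, m, h⟩ := hφ
  exact ⟨C, hC, m, fun x y => by simpa only [neg_sub_neg, abs_sub_comm] using h x y⟩

theorem LocLip.of_lipschitzWith {V : Type*} [NormedAddCommGroup V] {K : NNReal} {g : V → ℝ}
    (hg : LipschitzWith K g) : LocLip g := by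
  refine ⟨K + 1, by positivity, 0, fun x y => ?_⟩
  calc |g x - g y| ≤ K * ‖x - y‖ := by
        simpa only [dist_eq_norm, Real.norm_eq_abs] using hg.dist_le_mul x y
    _ ≤ (K + 1) * (1 + ‖x‖ ^ 0 + ‖y‖ ^ 0) * ‖x - y‖ := by
        gcongr
        simp only [pow_zero]
        linarith [K.coe_nonneg]

theorem LocLip.comp_lipschitzWith {V W : Type*} [NormedAddCommGroup V] [NormedAddCommGroup W]
    {ψ : W → ℝ} (hψ : LocLip ψ) {K : NNReal} {f : V → W} (hf : LipschitzWith K f) :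
    LocLip (fun x => ψ (f x)) := by
  obtain ⟨C, hC, m, h⟩ := hψ
  set B : ℝ := 2 ^ (m - 1) * (‖f 0‖ ^ m + K ^ m)
  have : 0 ≤ B := by positivity
  have norm_pow_le (x : V) : ‖f x‖ ^ m ≤ B * (1 + ‖x‖ ^ m) := by
    have norm_le : ‖f x‖ ≤ ‖f 0‖ + K * ‖x‖ := by
      have h0 : ‖f x - f 0‖ ≤ K * ‖x‖ := by
        simpa only [dist_eq_norm, sub_zero] using hf.dist_le_mul x 0
      linarith [norm_le_norm_add_norm_sub' (f x) (f 0)]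
    calc ‖f x‖ ^ m ≤ (‖f 0‖ + K * ‖x‖) ^ m := by gcongr
      _ ≤ 2 ^ (m - 1) * (‖f 0‖ ^ m + (K * ‖x‖) ^ m) := add_pow_le (by positivity) (by positivity) m
      _ ≤ 2 ^ (m - 1) * ((‖f 0‖ ^ m + K ^ m) * (1 + ‖x‖ ^ m)) := by
          gcongr
          have hcross : 0 ≤ ‖f 0‖ ^ m * ‖x‖ ^ m + (K : ℝ) ^ m := by positivity
          rw [mul_pow]
          linarith
      _ = B * (1 + ‖x‖ ^ m) := by ring
  refine ⟨C * (1 + 2 * B) * (K + 1), by positivity, m, fun x y => ?_⟩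
  have hdist : ‖f x - f y‖ ≤ K * ‖x - y‖ := by
    simpa only [dist_eq_norm] using hf.dist_le_mul x y
  have hweight : 1 + ‖f x‖ ^ m + ‖f y‖ ^ m ≤ (1 + 2 * B) * (1 + ‖x‖ ^ m + ‖y‖ ^ m) := by
    have hcross : 0 ≤ (1 + B) * (‖x‖ ^ m + ‖y‖ ^ m) := by positivity
    linarith [norm_pow_le x, norm_pow_le y]
  calc |ψ (f x) - ψ (f y)| ≤ C * (1 + ‖f x‖ ^ m + ‖f y‖ ^ m) * ‖f x - f y‖ := h _ _
    _ ≤ C * ((1 + 2 * B) * (1 + ‖x‖ ^ m + ‖y‖ ^ m)) * ((K + 1) * ‖x - y‖) := by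
        gcongr
        exact hdist.trans (by gcongr; linarith)
    _ = C * (1 + 2 * B) * (K + 1) * (1 + ‖x‖ ^ m + ‖y‖ ^ m) * ‖x - y‖ := by ring

theorem LocLip.infDist_sq {V : Type*} [NormedAddCommGroup V] (s : Set V) :
    LocLip (fun x => Metric.infDist x s ^ 2) := by
  simpa using (LocLip.norm_pow 2).comp_lipschitzWith (Metric.lipschitz_infDist_pt s)

theorem LocLip.norm_sub_sq {V : Type*} [NormedAddCommGroup V] (c : V) :
    LocLip (fun x => ‖x - c‖ ^ 2) := by
  simpa only [neg_add_eq_sub] using (LocLip.norm_pow 2).comp_add (-c)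

theorem LocLip.norm_add_sub_sq {V : Type*} [NormedAddCommGroup V] (q v : V) :
    LocLip (fun x => ‖q + (x - v)‖ ^ 2) := by
  simpa only [sub_add_eq_add_sub, add_sub_assoc] using (LocLip.norm_pow 2).comp_add (q - v)

theorem LocLip.inner_right {V : Type*} [NormedAddCommGroup V] [InnerProductSpace ℝ V] (p : V) :
    LocLip (fun x : V => inner ℝ p x) :=
  LocLip.of_lipschitzWith (innerSL ℝ p).lipschitz

theorem LocLip.continuous {V : Type*} [NormedAddCommGroup V] {φ : V → ℝ} (hφ : LocLip φ) :
    Continuous φ := by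
  obtain ⟨C, -, m, h⟩ := hφ
  refine continuous_iff_continuousAt.2 fun x => tendsto_iff_norm_sub_tendsto_zero.2 ?_
  have hbound : Continuous fun y : V => C * (1 + ‖y‖ ^ m + ‖x‖ ^ m) * ‖y - x‖ := by fun_prop
  exact squeeze_zero (fun _ => norm_nonneg _) (fun y => h y x) (by simpa using hbound.tendsto x)

/-! ### Approximation by Lipschitz functions -/

theorem exists_lipschitzWith_abs_sub_le_of_coarse_lipschitz {X : Type*} [PseudoMetricSpace X]
    {f : X → ℝ} {ε : ℝ} {K : NNReal} (hf : ∀ x y, f x ≤ f y + K * dist x y + ε) :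
    ∃ g : X → ℝ, LipschitzWith K g ∧ ∀ x, |f x - g x| ≤ ε := by
  -- The inf-convolution of `f` with `K * dist` is the largest `K`-Lipschitz minorant of `f`.
  have hbdd (x : X) : BddBelow (Set.range fun y => f y + K * dist x y) :=
    ⟨f x - ε, by rintro _ ⟨y, rfl⟩; linarith [hf x y]⟩
  refine ⟨fun x => ⨅ y, f y + K * dist x y, LipschitzWith.of_le_add_mul K fun x z => ?_,
    fun x => ?_⟩
  · have : Nonempty X := ⟨x⟩
    refine sub_le_iff_le_add.1 (le_ciInf fun y => sub_le_iff_le_add.2 ?_)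
    calc ⨅ y, f y + K * dist x y ≤ f y + K * dist x y := ciInf_le (hbdd x) y
      _ ≤ f y + K * (dist x z + dist z y) := by gcongr; exact dist_triangle x z y
      _ = f y + K * dist z y + K * dist x z := by ring
  · have : Nonempty X := ⟨x⟩
    have hle : ⨅ y, f y + K * dist x y ≤ f x := by simpa using ciInf_le (hbdd x) x
    have hge : f x - ε ≤ ⨅ y, f y + K * dist x y := le_ciInf fun y => by linarith [hf x y]
    rw [abs_of_nonneg (sub_nonneg.2 hle)]
    linarith

theorem exists_lipschitzWith_abs_sub_le_of_uniformContinuous {X : Type*} [PseudoMetricSpace X]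
    {f : X → ℝ} (hf : UniformContinuous f) {B : ℝ} (hB : ∀ x, |f x| ≤ B) {ε : ℝ} (hε : 0 < ε) :
    ∃ (K : NNReal) (g : X → ℝ), LipschitzWith K g ∧ ∀ x, |f x - g x| ≤ ε := by
  obtain ⟨δ, hδ, hunif⟩ := Metric.uniformContinuous_iff.1 hf ε hε
  refine ⟨_, exists_lipschitzWith_abs_sub_le_of_coarse_lipschitz
    (K := Real.toNNReal (2 * B / δ)) fun x y => ?_⟩
  have hB0 : 0 ≤ B := (abs_nonneg _).trans (hB x)
  rw [Real.coe_toNNReal _ (by positivity)]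
  rcases lt_or_ge (dist x y) δ with hxy | hxy
  · have hclose := (abs_lt.1 (hunif hxy)).2
    have hnonneg : 0 ≤ 2 * B / δ * dist x y := by positivity
    linarith
  · have hfar : 2 * B ≤ 2 * B / δ * dist x y := by
      rw [div_mul_eq_mul_div, le_div_iff₀ hδ]
      gcongr
    linarith [(abs_le.1 (hB x)).2, (abs_le.1 (hB y)).1]

theorem exists_hasCompactSupport_abs_sub_le_of_isLittleO {X : Type*} [TopologicalSpace X]
    [RegularSpace X] [LocallyCompactSpace X] {φ w : X → ℝ} (hφ : Continuous φ) (hw : ∀ x, 0 ≤ w x)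
    (hφw : φ =o[cocompact X] w) {ε : ℝ} (hε : 0 < ε) :
    ∃ ψ : X → ℝ, Continuous ψ ∧ HasCompactSupport ψ ∧ ∀ x, |φ x - ψ x| ≤ ε * w x := by
  obtain ⟨k, hk, hsmall⟩ := hasBasis_cocompact.eventually_iff.1 (hφw.def hε)
  obtain ⟨χ, hχ_one, -, hχ_supp, hχ⟩ :=
    exists_continuous_one_zero_of_isCompact hk isClosed_empty (Set.disjoint_empty k)
  refine ⟨fun x => φ x * χ x, hφ.mul χ.continuous, hχ_supp.mul_left, fun x => ?_⟩
  by_cases hx : x ∈ k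
  · simpa [hχ_one hx] using mul_nonneg hε.le (hw x)
  · obtain ⟨hχ0, hχ1⟩ := hχ x
    calc |φ x - φ x * χ x| = |φ x| * (1 - χ x) := by
          rw [← mul_one_sub, abs_mul, abs_of_nonneg (sub_nonneg.2 hχ1)]
      _ ≤ |φ x| := mul_le_of_le_one_right (abs_nonneg _) (by linarith)
      _ ≤ ε * w x := by simpa [abs_of_nonneg (hw x)] using hsmall hx

theorem exists_lipschitzWith_abs_sub_le_of_isLittleO {V : Type*} [NormedAddCommGroup V]
    [ProperSpace V] {φ : V → ℝ} (hφ : Continuous φ) {q : ℕ}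
    (hφq : φ =o[cocompact V] fun x => ‖x‖ ^ q) {ε : ℝ} (hε : 0 < ε) :
    ∃ (K : NNReal) (g : V → ℝ), LipschitzWith K g ∧ ∀ x, |φ x - g x| ≤ ε * (1 + ‖x‖ ^ q) := by
  obtain ⟨ψ, hψ, hψ_supp, hφψ⟩ :=
    exists_hasCompactSupport_abs_sub_le_of_isLittleO hφ (fun x => by positivity) hφq hε
  obtain ⟨B, hB⟩ := hψ_supp.exists_bound_of_continuous hψ
  obtain ⟨K, g, hg, hψg⟩ :=
    exists_lipschitzWith_abs_sub_le_of_uniformContinuous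
      (hψ_supp.uniformContinuous_of_continuous hψ) hB hε
  refine ⟨K, g, hg, fun x => ?_⟩
  calc |φ x - g x| ≤ |φ x - ψ x| + |ψ x - g x| := abs_sub_le _ _ _
    _ ≤ ε * ‖x‖ ^ q + ε := add_le_add (hφψ x) (hψg x)
    _ = ε * (1 + ‖x‖ ^ q) := by ring

theorem isLittleO_cocompact_norm_pow_succ {V : Type*} [NormedAddCommGroup V] [ProperSpace V]
    {φ : V → ℝ} {C : ℝ} {m : ℕ} (hC : ∀ x, |φ x| ≤ C * (1 + ‖x‖ ^ m)) :
    φ =o[cocompact V] fun x => ‖x‖ ^ (m + 1) := by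
  have hbigO : φ =O[cocompact V] fun x => 1 + ‖x‖ ^ m :=
    .of_bound C <| .of_forall fun x => by
      rw [Real.norm_eq_abs, Real.norm_of_nonneg (by positivity)]
      exact hC x
  have hpow : (fun t : ℝ => 1 + t ^ m) =o[atTop] fun t => t ^ (m + 1) := by
    refine .add ?_ (isLittleO_pow_pow_atTop_of_lt m.lt_succ_self)
    simpa using isLittleO_pow_pow_atTop_of_lt (𝕜 := ℝ) m.succ_pos
  exact hbigO.trans_isLittleO (hpow.comp_tendsto tendsto_norm_cocompact_atTop)

/-! ### Support functions -/

theorem exists_linearMap_le_of_sublinear {V : Type*} [AddCommGroup V] [Module ℝ V] {G : V → ℝ}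
    (hG_smul : ∀ c : ℝ, 0 < c → ∀ x, G (c • x) = c * G x)
    (hG_add : ∀ x y, G (x + y) ≤ G x + G y) (p : V) :
    ∃ f : V →ₗ[ℝ] ℝ, f p = G p ∧ ∀ x, f x ≤ G x := by
  have hG0 : G 0 = 0 := by
    have := hG_smul 2 two_pos 0
    rw [smul_zero] at this
    linarith
  have hker (c : ℝ) (hc : c • p = 0) : c • G p = 0 := by
    rcases smul_eq_zero.1 hc with rfl | rfl
    · exact zero_smul ℝ _
    · rw [hG0, smul_zero]
  have hspan (c : ℝ) : c * G p ≤ G (c • p) := by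
    rcases lt_trichotomy c 0 with hc | rfl | hc
    · have := hG_add (c • p) ((-c) • p)
      rw [hG_smul (-c) (neg_pos.2 hc), neg_smul, add_neg_cancel, hG0] at this
      linarith
    · simp [hG0]
    · exact (hG_smul c hc p).ge
  obtain ⟨f, hf, hfG⟩ := exists_extension_of_le_sublinear
    (LinearPMap.mkSpanSingleton' p (G p) hker) G hG_smul hG_add (by
      rintro ⟨x, hx⟩
      obtain ⟨c, rfl⟩ := Submodule.mem_span_singleton.1 hx
      simpa only [LinearPMap.mkSpanSingleton'_apply, RingHom.id_apply, smul_eq_mul] using hspan c)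
  exact ⟨f, (hf ⟨p, Submodule.mem_span_singleton_self p⟩).trans
    (LinearPMap.mkSpanSingleton'_apply_self p (G p) hker _), hfG⟩

theorem eq_setOf_inner_le_of_isGreatest {V : Type*} [NormedAddCommGroup V]
    [InnerProductSpace ℝ V] [CompleteSpace V] {Γ : Set V} (hconvex : Convex ℝ Γ)
    (hclosed : IsClosed Γ) {G : V → ℝ}
    (hG : ∀ p, IsGreatest ((fun v => inner ℝ p v) '' Γ) (G p)) :
    Γ = {v | ∀ p, inner ℝ p v ≤ G p} := by
  refine Set.Subset.antisymm (fun v hv p => (hG p).2 ⟨v, hv, rfl⟩) fun v hv => ?_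
  rw [← iInter_halfSpaces_eq hconvex hclosed, Set.mem_iInter]
  intro l
  set p := (InnerProductSpace.toDual ℝ V).symm l
  have hl (x : V) : inner ℝ p x = l x := InnerProductSpace.toDual_symm_apply
  obtain ⟨y, hy, hyG⟩ := (hG p).1
  refine ⟨y, hy, ?_⟩
  rw [← hl, ← hl]
  exact (hv p).trans hyG.ge

/-! ### Sublinear expectations -/

namespace SublinearExpectation

variable {Ω : Type*} [MeasurableSpace Ω] (S : SublinearExpectation Ω)

theorem sq_mem {f : Ω → ℝ} (hf : f ∈ S.H) : (fun ω => f ω ^ 2) ∈ S.H := by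
  simpa [EuclideanSpace.norm_sq_eq] using
    S.comp_mem 1 (fun _ => f) (fun _ => hf) _ (LocLip.norm_pow 2)

theorem neg_mem {f : Ω → ℝ} (hf : f ∈ S.H) : (fun ω => -f ω) ∈ S.H := by
  simpa only [neg_one_mul] using S.smul_mem (-1) hf

theorem sum_mem {ι : Type*} (s : Finset ι) {f : ι → Ω → ℝ} (hf : ∀ i, f i ∈ S.H) :
    (fun ω => ∑ i ∈ s, f i ω) ∈ S.H := by
  classical
  induction s using Finset.induction_on with
  | empty => simpa using S.const_mem 0
  | insert i s hi ih => simpa only [Finset.sum_insert hi] using S.add_mem (hf i) ih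

theorem E_nonneg {f : Ω → ℝ} (hf : f ∈ S.H) (hf0 : ∀ ω, 0 ≤ f ω) : 0 ≤ S.E f :=
  (S.const 0).ge.trans (S.mono f hf _ (S.const_mem 0) hf0)

theorem E_const_add_mul {f : Ω → ℝ} (hf : f ∈ S.H) (a : ℝ) {b : ℝ} (hb : 0 ≤ b) :
    S.E (fun ω => a + b * f ω) = a + b * S.E f := by
  have hbf := S.smul_mem b hf
  have hle := S.subadd _ (S.const_mem a) _ hbf
  have hge := S.subadd _ (S.const_mem (-a)) _ (S.add_mem (S.const_mem a) hbf)
  simp only [neg_add_cancel_left] at hge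
  rw [S.const, S.posHom b hb f hf] at hle hge
  linarith

theorem E_le_const_add_mul {f h : Ω → ℝ} (hf : f ∈ S.H) (hh : h ∈ S.H) {a b : ℝ} (hb : 0 ≤ b)
    (hle : ∀ ω, f ω ≤ a + b * h ω) : S.E f ≤ a + b * S.E h :=
  (S.mono _ (S.add_mem (S.const_mem a) (S.smul_mem b hh)) f hf hle).trans_eq
    (S.E_const_add_mul hh a hb)

theorem const_add_mul_le_E {f h : Ω → ℝ} (hf : f ∈ S.H) (hh : h ∈ S.H) {a b : ℝ} (hb : 0 ≤ b)
    (hle : ∀ ω, a + b * h ω ≤ f ω) : a + b * S.E h ≤ S.E f :=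
  (S.E_const_add_mul hh a hb).ge.trans
    (S.mono f hf _ (S.add_mem (S.const_mem a) (S.smul_mem b hh)) hle)

theorem E_sum_le {ι : Type*} (s : Finset ι) {f : ι → Ω → ℝ} (hf : ∀ i, f i ∈ S.H) :
    S.E (fun ω => ∑ i ∈ s, f i ω) ≤ ∑ i ∈ s, S.E (f i) := by
  classical
  induction s using Finset.induction_on with
  | empty => simp [S.const]
  | insert i s hi ih =>
    simp only [Finset.sum_insert hi]
    exact (S.subadd _ (hf i) _ (S.sum_mem s hf)).trans (by gcongr)

theorem E_le_sqrt_E_sq {f : Ω → ℝ} (hf : f ∈ S.H) : S.E f ≤ √(S.E fun ω => f ω ^ 2) := by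
  rcases le_total (S.E f) 0 with hneg | hpos
  · exact hneg.trans (Real.sqrt_nonneg _)
  refine Real.le_sqrt_of_sq_le ?_
  have hle := S.const_add_mul_le_E (S.sq_mem hf) hf (a := -(S.E f) ^ 2) (b := 2 * S.E f)
    (by positivity) fun ω => by linarith [sq_nonneg (f ω - S.E f)]
  linarith

theorem neg_sqrt_neg_E_neg_sq_le {f : Ω → ℝ} (hf : f ∈ S.H) :
    -√(-S.E fun ω => -f ω ^ 2) ≤ S.E fun ω => -f ω := by
  obtain ⟨c, hc⟩ : ∃ c, S.E (fun ω => -f ω) = -c := ⟨_, (neg_neg _).symm⟩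
  rw [hc, neg_le_neg_iff]
  rcases le_total c 0 with hneg | hpos
  · exact hneg.trans (Real.sqrt_nonneg _)
  refine Real.le_sqrt_of_sq_le ?_
  have hle := S.E_le_const_add_mul (S.neg_mem (S.sq_mem hf)) (S.neg_mem hf) (a := c ^ 2)
    (b := 2 * c) (by positivity) fun ω => by linarith [sq_nonneg (f ω - c)]
  rw [hc] at hle
  linarith

variable {d : ℕ}

theorem IsRandomVector.const_smul {S : SublinearExpectation Ω} {Y : Ω → EuclideanSpace ℝ (Fin d)}
    (hY : S.IsRandomVector Y) (c : ℝ) : S.IsRandomVector (fun ω => c • Y ω) :=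
  fun i => S.smul_mem c (hY i)

theorem IsRandomVector.sum {S : SublinearExpectation Ω} {ι : Type*} (s : Finset ι)
    {X : ι → Ω → EuclideanSpace ℝ (Fin d)} (hX : ∀ i, S.IsRandomVector (X i)) :
    S.IsRandomVector (fun ω => ∑ i ∈ s, X i ω) := fun j => by
  simpa using S.sum_mem s fun i => hX i j

theorem E_norm_smul_sum_range_pow_le {X : ℕ → Ω → EuclideanSpace ℝ (Fin d)}
    (hX : ∀ i, S.IsRandomVector (X i)) (hid : ∀ i, IdentDistributed S S (X i) (X 0)) (n m : ℕ) :
    S.E (fun ω => ‖(n : ℝ)⁻¹ • ∑ i ∈ Finset.range n, X i ω‖ ^ (m + 1)) ≤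
      S.E (fun ω => ‖X 0 ω‖ ^ (m + 1)) := by
  have hmem (i : ℕ) : (fun ω => ‖X i ω‖ ^ (m + 1)) ∈ S.H :=
    S.comp_vec_mem (hX i) (LocLip.norm_pow (m + 1))
  have hjensen (ω : Ω) : ‖(n : ℝ)⁻¹ • ∑ i ∈ Finset.range n, X i ω‖ ^ (m + 1) ≤
      (n : ℝ)⁻¹ * ∑ i ∈ Finset.range n, ‖X i ω‖ ^ (m + 1) := by
    calc ‖(n : ℝ)⁻¹ • ∑ i ∈ Finset.range n, X i ω‖ ^ (m + 1)
        ≤ ((n : ℝ)⁻¹ * ∑ i ∈ Finset.range n, ‖X i ω‖) ^ (m + 1) := by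
          rw [norm_smul_of_nonneg (by positivity)]
          gcongr
          exact norm_sum_le _ _
      _ = (n : ℝ)⁻¹ * ((∑ i ∈ Finset.range n, ‖X i ω‖) ^ (m + 1) / n ^ m) := by
          rw [mul_pow, div_eq_mul_inv, ← inv_pow]
          ring
      _ ≤ (n : ℝ)⁻¹ * ∑ i ∈ Finset.range n, ‖X i ω‖ ^ (m + 1) := by
          gcongr
          simpa only [Finset.card_range] using pow_sum_div_card_le_sum_pow
            (s := Finset.range n) (f := fun i => ‖X i ω‖) (fun i _ => norm_nonneg _) m
  have hsum : S.E (fun ω => ∑ i ∈ Finset.range n, ‖X i ω‖ ^ (m + 1)) ≤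
      n * S.E (fun ω => ‖X 0 ω‖ ^ (m + 1)) := by
    refine (S.E_sum_le _ hmem).trans_eq ?_
    simp only [hid _ _ (LocLip.norm_pow (m + 1)), Finset.sum_const, Finset.card_range,
      nsmul_eq_mul]
  calc S.E (fun ω => ‖(n : ℝ)⁻¹ • ∑ i ∈ Finset.range n, X i ω‖ ^ (m + 1))
      ≤ (n : ℝ)⁻¹ * S.E (fun ω => ∑ i ∈ Finset.range n, ‖X i ω‖ ^ (m + 1)) := by
        have hle := S.E_le_const_add_mul (a := 0)
          (S.comp_vec_mem ((IsRandomVector.sum _ hX).const_smul _) (LocLip.norm_pow (m + 1)))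
          (S.sum_mem (Finset.range n) hmem) (b := (n : ℝ)⁻¹) (by positivity)
          fun ω => by simpa only [zero_add] using hjensen ω
        simpa only [zero_add] using hle
    _ ≤ (n : ℝ)⁻¹ * n * S.E (fun ω => ‖X 0 ω‖ ^ (m + 1)) := by
        rw [mul_assoc]
        gcongr
    _ ≤ S.E (fun ω => ‖X 0 ω‖ ^ (m + 1)) :=
        mul_le_of_le_one_left (S.E_nonneg (hmem 0) fun ω => by positivity) inv_mul_le_one

/-! ### The mean set of a random vector -/

/-- The set of mean vectors of `Y`: the largest set whose support function is at most
`p ↦ E[⟨p, Y⟩]`. It plays the role of `Γ` in the law of large numbers. -/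
def meanSet (Y : Ω → EuclideanSpace ℝ (Fin d)) : Set (EuclideanSpace ℝ (Fin d)) :=
  {v | ∀ p, inner ℝ p v ≤ S.E (fun ω => inner ℝ p (Y ω))}

variable {S} {Y : Ω → EuclideanSpace ℝ (Fin d)}

theorem IsRandomVector.inner_mem (hY : S.IsRandomVector Y) (p : EuclideanSpace ℝ (Fin d)) :
    (fun ω => inner ℝ p (Y ω)) ∈ S.H :=
  S.comp_vec_mem hY (LocLip.inner_right p)

theorem isClosed_meanSet : IsClosed (S.meanSet Y) := by
  simp only [meanSet, Set.ofPred_forall]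
  exact isClosed_iInter fun p => isClosed_le (by fun_prop) continuous_const

theorem convex_meanSet : Convex ℝ (S.meanSet Y) := by
  simp only [meanSet, Set.ofPred_forall]
  exact convex_iInter fun p => convex_halfSpace_le (innerSL ℝ p).isLinear _

theorem norm_sq_le_of_mem_meanSet (hY : S.IsRandomVector Y) {v : EuclideanSpace ℝ (Fin d)}
    (hv : v ∈ S.meanSet Y) : ‖v‖ ^ 2 ≤ S.E (fun ω => ‖Y ω‖ ^ 2) := by
  have hle := S.E_le_const_add_mul (hY.inner_mem v) (S.norm_sq_mem hY) (a := ‖v‖ ^ 2 / 2)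
    (b := 1 / 2) (by norm_num) fun ω => by
      have hsq := norm_sub_sq_real v (Y ω)
      linarith [sq_nonneg ‖v - Y ω‖]
  have hvv := hv v
  rw [real_inner_self_eq_norm_sq] at hvv
  linarith

theorem isCompact_meanSet (hY : S.IsRandomVector Y) : IsCompact (S.meanSet Y) :=
  Metric.isCompact_of_isClosed_isBounded isClosed_meanSet <|
    isBounded_iff_forall_norm_le.2 ⟨_, fun _ hv =>
      Real.le_sqrt_of_sq_le (norm_sq_le_of_mem_meanSet hY hv)⟩

theorem isGreatest_inner_meanSet (hY : S.IsRandomVector Y) (p : EuclideanSpace ℝ (Fin d)) :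
    IsGreatest ((fun v => inner ℝ p v) '' S.meanSet Y) (S.E (fun ω => inner ℝ p (Y ω))) := by
  obtain ⟨f, hfp, hf⟩ := exists_linearMap_le_of_sublinear
    (G := fun q => S.E (fun ω => inner ℝ q (Y ω)))
    (fun c hc q => by
      simpa only [real_inner_smul_left] using S.posHom c hc.le _ (hY.inner_mem q))
    (fun q r => by
      simpa only [inner_add_left] using S.subadd _ (hY.inner_mem q) _ (hY.inner_mem r)) p
  set v := (InnerProductSpace.toDual ℝ _).symm f.toContinuousLinearMap
  have hv (q : EuclideanSpace ℝ (Fin d)) : inner ℝ q v = f q := by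
    rw [real_inner_comm]
    exact InnerProductSpace.toDual_symm_apply
  refine ⟨⟨v, fun q => (hv q).trans_le (hf q), (hv p).trans hfp⟩, ?_⟩
  rintro _ ⟨w, hw, rfl⟩
  exact hw p

theorem nonempty_meanSet (hY : S.IsRandomVector Y) : (S.meanSet Y).Nonempty :=
  (isGreatest_inner_meanSet hY 0).nonempty.of_image

theorem E_norm_sub_sq_le_of_mem_meanSet (hY : S.IsRandomVector Y)
    {v : EuclideanSpace ℝ (Fin d)} (hv : v ∈ S.meanSet Y) :
    S.E (fun ω => ‖Y ω - v‖ ^ 2) ≤ 4 * S.E (fun ω => ‖Y ω‖ ^ 2) := by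
  have hle := S.E_le_const_add_mul (S.comp_vec_mem hY (LocLip.norm_sub_sq v))
    (S.norm_sq_mem hY) (a := 2 * ‖v‖ ^ 2) (b := 2) (by norm_num) fun ω => by
      linarith [parallelogram_law_with_norm ℝ (Y ω) v, mul_self_nonneg ‖Y ω + v‖]
  linarith [norm_sq_le_of_mem_meanSet hY hv]

/-! ### Drift of squared distances -/

theorem E_norm_add_sub_sq_le (hY : S.IsRandomVector Y) {q v : EuclideanSpace ℝ (Fin d)}
    (hv : v ∈ S.meanSet Y) (hq : S.E (fun ω => inner ℝ q (Y ω)) ≤ inner ℝ q v) :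
    S.E (fun ω => ‖q + (Y ω - v)‖ ^ 2) ≤ ‖q‖ ^ 2 + 4 * S.E (fun ω => ‖Y ω‖ ^ 2) := by
  have hsq := S.comp_vec_mem hY (LocLip.norm_sub_sq v)
  have hin := S.smul_mem 2 (hY.inner_mem q)
  have hadd := S.subadd _ hin _ hsq
  rw [S.posHom 2 zero_le_two _ (hY.inner_mem q)] at hadd
  have hle := S.E_le_const_add_mul
    (S.comp_vec_mem hY (LocLip.norm_add_sub_sq q v)) (S.add_mem hin hsq)
    (a := ‖q‖ ^ 2 - 2 * inner ℝ q v) zero_le_one fun ω => by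
      rw [norm_add_sq_real, inner_sub_right]
      linarith
  linarith [E_norm_sub_sq_le_of_mem_meanSet hY hv]

theorem le_E_neg_norm_add_sub_sq (hY : S.IsRandomVector Y) (q : EuclideanSpace ℝ (Fin d))
    {v : EuclideanSpace ℝ (Fin d)} (hv : v ∈ S.meanSet Y) :
    -‖q‖ ^ 2 - 4 * S.E (fun ω => ‖Y ω‖ ^ 2) ≤ S.E (fun ω => -‖q + (Y ω - v)‖ ^ 2) := by
  have hsq := S.comp_vec_mem hY (LocLip.norm_sub_sq v)
  have hmem := S.comp_vec_mem hY (LocLip.norm_add_sub_sq q v).neg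
  have hadd := S.subadd _ hmem _ hsq
  have hle := S.const_add_mul_le_E (S.add_mem hmem hsq) (hY.inner_mem (-q))
    (a := -‖q‖ ^ 2 + 2 * inner ℝ q v) zero_le_two fun ω => by
      rw [norm_add_sq_real, inner_sub_right, inner_neg_left]
      linarith
  have hqv := hv (-q)
  rw [inner_neg_left] at hqv
  linarith [E_norm_sub_sq_le_of_mem_meanSet hY hv]

section SumRange

variable {X : ℕ → Ω → EuclideanSpace ℝ (Fin d)}

theorem IsConvolutionary.isConvolution_sum_range (hX : S.IsConvolutionary X) (n : ℕ) :
    S.IsConvolution (X n) (fun ω => ∑ i ∈ Finset.range n, X i ω) := by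
  cases n with
  | zero => exact fun φ _ => by simp [S.const]
  | succ n => simpa only [Nat.range_succ_eq_Icc_zero] using hX n 0 n.zero_le

theorem E_sum_range_succ (hid : ∀ i, IdentDistributed S S (X i) (X 0))
    (hconv : ∀ n, S.IsConvolution (X n) (fun ω => ∑ i ∈ Finset.range n, X i ω))
    {φ : EuclideanSpace ℝ (Fin d) → ℝ} (hφ : LocLip φ) (n : ℕ) :
    S.E (fun ω => φ (∑ i ∈ Finset.range (n + 1), X i ω)) =
      S.E (fun ω => S.E (fun ω' => φ (∑ i ∈ Finset.range n, X i ω + X 0 ω'))) := by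
  simp only [Finset.sum_range_succ, hconv n φ hφ, hid n _ (hφ.comp_add _)]

theorem E_sum_range_le (hX : ∀ i, S.IsRandomVector (X i))
    (hid : ∀ i, IdentDistributed S S (X i) (X 0))
    (hconv : ∀ n, S.IsConvolution (X n) (fun ω => ∑ i ∈ Finset.range n, X i ω))
    {f : ℕ → EuclideanSpace ℝ (Fin d) → ℝ} (hf : ∀ k, LocLip (f k)) {C : ℝ}
    (hstep : ∀ k x, S.E (fun ω => f (k + 1) (x + X 0 ω)) ≤ f k x + C) (n : ℕ) :
    S.E (fun ω => f n (∑ i ∈ Finset.range n, X i ω)) ≤ f 0 0 + n * C := by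
  induction n with
  | zero => simp [S.const]
  | succ n ih =>
    have hsum := IsRandomVector.sum (Finset.range n) hX
    have hle := S.E_le_const_add_mul
      (S.comp_vec_mem hsum (S.locLip_inner (hX 0) (hf (n + 1)))) (S.comp_vec_mem hsum (hf n))
      (a := C) zero_le_one fun ω => by
        simpa only [one_mul, add_comm C] using hstep n (∑ i ∈ Finset.range n, X i ω)
    rw [E_sum_range_succ hid hconv (hf (n + 1))]
    push_cast
    linarith

theorem le_E_sum_range (hX : ∀ i, S.IsRandomVector (X i))
    (hid : ∀ i, IdentDistributed S S (X i) (X 0))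
    (hconv : ∀ n, S.IsConvolution (X n) (fun ω => ∑ i ∈ Finset.range n, X i ω))
    {f : ℕ → EuclideanSpace ℝ (Fin d) → ℝ} (hf : ∀ k, LocLip (f k)) {C : ℝ}
    (hstep : ∀ k x, f k x - C ≤ S.E (fun ω => f (k + 1) (x + X 0 ω))) (n : ℕ) :
    f 0 0 - n * C ≤ S.E (fun ω => f n (∑ i ∈ Finset.range n, X i ω)) := by
  induction n with
  | zero => simp [S.const]
  | succ n ih =>
    have hsum := IsRandomVector.sum (Finset.range n) hX
    have hle := S.const_add_mul_le_E
      (S.comp_vec_mem hsum (S.locLip_inner (hX 0) (hf (n + 1)))) (S.comp_vec_mem hsum (hf n))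
      (a := -C) zero_le_one fun ω => by
        simpa only [one_mul, neg_add_eq_sub] using hstep n (∑ i ∈ Finset.range n, X i ω)
    rw [E_sum_range_succ hid hconv (hf (n + 1))]
    push_cast
    linarith

open scoped Pointwise

theorem E_infDist_sum_range_sq_le (hX : ∀ i, S.IsRandomVector (X i))
    (hid : ∀ i, IdentDistributed S S (X i) (X 0))
    (hconv : ∀ n, S.IsConvolution (X n) (fun ω => ∑ i ∈ Finset.range n, X i ω)) (n : ℕ) :
    S.E (fun ω => Metric.infDist (∑ i ∈ Finset.range n, X i ω) ((n : ℝ) • S.meanSet (X 0)) ^ 2) ≤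
      n * (4 * S.E (fun ω => ‖X 0 ω‖ ^ 2)) := by
  set Γ := S.meanSet (X 0)
  have hne : Γ.Nonempty := nonempty_meanSet (hX 0)
  have hLip (k : ℕ) : LocLip (fun x => Metric.infDist x ((k : ℝ) • Γ) ^ 2) := LocLip.infDist_sq _
  refine (E_sum_range_le hX hid hconv hLip (C := 4 * S.E (fun ω => ‖X 0 ω‖ ^ 2))
    (fun k x => ?_) n).trans_eq ?_
  swap
  · have hzero : Metric.infDist 0 (((0 : ℕ) : ℝ) • Γ) = 0 :=
      Metric.infDist_zero_of_mem (by simp [Set.zero_smul_set hne])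
    simp only [hzero, zero_pow two_ne_zero, zero_add]
  obtain ⟨z, hz, hxz⟩ :=
    ((isCompact_meanSet (hX 0)).smul (k : ℝ)).exists_infDist_eq_dist hne.smul_set x
  obtain ⟨v, hv, hxv⟩ := (isGreatest_inner_meanSet (hX 0) (x - z)).1
  have hzv : z + v ∈ ((k + 1 : ℕ) : ℝ) • Γ := by
    rw [Nat.cast_succ, convex_meanSet.add_smul k.cast_nonneg zero_le_one, one_smul]
    exact Set.add_mem_add hz hv
  have hdist (y : EuclideanSpace ℝ (Fin d)) :
      Metric.infDist (x + y) (((k + 1 : ℕ) : ℝ) • Γ) ^ 2 ≤ ‖(x - z) + (y - v)‖ ^ 2 := by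
    refine pow_le_pow_left₀ Metric.infDist_nonneg ?_ 2
    rw [← add_sub_add_comm, ← dist_eq_norm]
    exact Metric.infDist_le_dist_of_mem hzv
  calc S.E (fun ω => Metric.infDist (x + X 0 ω) (((k + 1 : ℕ) : ℝ) • Γ) ^ 2)
      ≤ S.E (fun ω => ‖(x - z) + (X 0 ω - v)‖ ^ 2) :=
        S.mono _ (S.comp_vec_mem (hX 0) (LocLip.norm_add_sub_sq (x - z) v)) _
          (S.comp_vec_mem (hX 0) ((hLip (k + 1)).comp_add x)) fun ω => hdist (X 0 ω)
    _ ≤ ‖x - z‖ ^ 2 + 4 * S.E (fun ω => ‖X 0 ω‖ ^ 2) := E_norm_add_sub_sq_le (hX 0) hv hxv.ge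
    _ = Metric.infDist x ((k : ℝ) • Γ) ^ 2 + 4 * S.E (fun ω => ‖X 0 ω‖ ^ 2) := by
        rw [hxz, dist_eq_norm]

theorem le_E_neg_norm_sum_range_sub_sq (hX : ∀ i, S.IsRandomVector (X i))
    (hid : ∀ i, IdentDistributed S S (X i) (X 0))
    (hconv : ∀ n, S.IsConvolution (X n) (fun ω => ∑ i ∈ Finset.range n, X i ω))
    {v : EuclideanSpace ℝ (Fin d)} (hv : v ∈ S.meanSet (X 0)) (n : ℕ) :
    -(n * (4 * S.E (fun ω => ‖X 0 ω‖ ^ 2))) ≤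
      S.E (fun ω => -‖∑ i ∈ Finset.range n, X i ω - (n : ℝ) • v‖ ^ 2) := by
  refine le_trans (by simp) <| le_E_sum_range hX hid hconv
    (f := fun k x => -‖x - (k : ℝ) • v‖ ^ 2) (fun k => (LocLip.norm_sub_sq _).neg)
    (C := 4 * S.E (fun ω => ‖X 0 ω‖ ^ 2)) (fun k x => ?_) n
  have hsplit (y : EuclideanSpace ℝ (Fin d)) :
      x + y - ((k + 1 : ℕ) : ℝ) • v = (x - (k : ℝ) • v) + (y - v) := by
    rw [Nat.cast_succ, add_smul, one_smul, add_sub_add_comm]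
  simpa only [hsplit] using le_E_neg_norm_add_sub_sq (hX 0) (x - (k : ℝ) • v) hv

theorem E_infDist_average_sq_le (hX : ∀ i, S.IsRandomVector (X i))
    (hid : ∀ i, IdentDistributed S S (X i) (X 0))
    (hconv : ∀ n, S.IsConvolution (X n) (fun ω => ∑ i ∈ Finset.range n, X i ω)) {n : ℕ}
    (hn : n ≠ 0) :
    S.E (fun ω => Metric.infDist ((n : ℝ)⁻¹ • ∑ i ∈ Finset.range n, X i ω)
      (S.meanSet (X 0)) ^ 2) ≤ 4 * S.E (fun ω => ‖X 0 ω‖ ^ 2) / n := by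
  have hn0 : (n : ℝ) ≠ 0 := Nat.cast_ne_zero.2 hn
  have hscale (x : EuclideanSpace ℝ (Fin d)) :
      Metric.infDist x ((n : ℝ) • S.meanSet (X 0)) ^ 2 =
        n ^ 2 * Metric.infDist ((n : ℝ)⁻¹ • x) (S.meanSet (X 0)) ^ 2 := by
    have h := infDist_smul₀ hn0 (S.meanSet (X 0)) ((n : ℝ)⁻¹ • x)
    rw [smul_inv_smul₀ hn0, RCLike.norm_natCast] at h
    rw [h, mul_pow]
  have hle := E_infDist_sum_range_sq_le hX hid hconv n
  simp only [hscale] at hle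
  rw [S.posHom _ (by positivity) _ (S.comp_vec_mem ((IsRandomVector.sum _ hX).const_smul _)
    (LocLip.infDist_sq _)), pow_two, mul_assoc] at hle
  rw [le_div_iff₀' (by positivity)]
  exact le_of_mul_le_mul_left hle (by positivity)

theorem le_E_neg_norm_average_sub_sq (hX : ∀ i, S.IsRandomVector (X i))
    (hid : ∀ i, IdentDistributed S S (X i) (X 0))
    (hconv : ∀ n, S.IsConvolution (X n) (fun ω => ∑ i ∈ Finset.range n, X i ω))
    {v : EuclideanSpace ℝ (Fin d)} (hv : v ∈ S.meanSet (X 0)) {n : ℕ} (hn : n ≠ 0) :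
    -(4 * S.E (fun ω => ‖X 0 ω‖ ^ 2) / n) ≤
      S.E (fun ω => -‖(n : ℝ)⁻¹ • ∑ i ∈ Finset.range n, X i ω - v‖ ^ 2) := by
  have hn0 : (n : ℝ) ≠ 0 := Nat.cast_ne_zero.2 hn
  have hscale (x : EuclideanSpace ℝ (Fin d)) :
      -‖x - (n : ℝ) • v‖ ^ 2 = n ^ 2 * -‖(n : ℝ)⁻¹ • x - v‖ ^ 2 := by
    rw [← smul_inv_smul₀ hn0 x, ← smul_sub, norm_smul, smul_inv_smul₀ hn0, RCLike.norm_natCast]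
    ring
  have hle := le_E_neg_norm_sum_range_sub_sq hX hid hconv hv n
  simp only [hscale] at hle
  rw [S.posHom _ (by positivity) _ (S.comp_vec_mem ((IsRandomVector.sum _ hX).const_smul _)
    (LocLip.norm_sub_sq v).neg), pow_two, mul_assoc, ← mul_neg] at hle
  rw [← neg_div, div_le_iff₀' (by positivity)]
  exact le_of_mul_le_mul_left hle (by positivity)

theorem abs_E_average_sub_le (hX : ∀ i, S.IsRandomVector (X i))
    (hid : ∀ i, IdentDistributed S S (X i) (X 0))
    (hconv : ∀ n, S.IsConvolution (X n) (fun ω => ∑ i ∈ Finset.range n, X i ω))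
    {K : NNReal} {g : EuclideanSpace ℝ (Fin d) → ℝ} (hg : LipschitzWith K g) {M : ℝ}
    (hM : IsGreatest (g '' S.meanSet (X 0)) M) {n : ℕ} (hn : n ≠ 0) :
    |S.E (fun ω => g ((n : ℝ)⁻¹ • ∑ i ∈ Finset.range n, X i ω)) - M| ≤
      K * √(4 * S.E (fun ω => ‖X 0 ω‖ ^ 2) / n) := by
  have havg := (IsRandomVector.sum (Finset.range n) hX).const_smul (n : ℝ)⁻¹
  have hgmem := S.comp_vec_mem havg (.of_lipschitzWith hg)
  rw [abs_sub_le_iff, sub_le_iff_le_add', sub_le_comm]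
  constructor
  · have hinfDist := S.comp_vec_mem havg
      (.of_lipschitzWith (Metric.lipschitz_infDist_pt (S.meanSet (X 0))))
    have hgM (x : EuclideanSpace ℝ (Fin d)) : g x ≤ M + K * Metric.infDist x (S.meanSet (X 0)) := by
      obtain ⟨v, hv, hxv⟩ := (isCompact_meanSet (hX 0)).exists_infDist_eq_dist
        (nonempty_meanSet (hX 0)) x
      rw [hxv]
      exact (hg.le_add_mul x v).trans (by gcongr; exact hM.2 ⟨v, hv, rfl⟩)
    refine (S.E_le_const_add_mul hgmem hinfDist K.coe_nonneg fun ω => hgM _).trans ?_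
    gcongr
    exact (S.E_le_sqrt_E_sq hinfDist).trans
      (Real.sqrt_le_sqrt (E_infDist_average_sq_le hX hid hconv hn))
  · obtain ⟨v, hv, rfl⟩ := hM.1
    have hdist := LipschitzWith.dist_left v
    simp only [dist_eq_norm] at hdist
    have hnorm := S.comp_vec_mem havg (.of_lipschitzWith hdist)
    have hgv (x : EuclideanSpace ℝ (Fin d)) : g v + K * -‖x - v‖ ≤ g x := by
      have := hg.le_add_mul v x
      rw [dist_comm, dist_eq_norm] at this
      linarith
    refine le_trans ?_ (S.const_add_mul_le_E hgmem (S.neg_mem hnorm) K.coe_nonneg fun ω => hgv _)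
    rw [sub_eq_add_neg, ← mul_neg]
    gcongr
    refine le_trans ?_ (S.neg_sqrt_neg_E_neg_sq_le hnorm)
    gcongr
    exact neg_le.1 (le_E_neg_norm_average_sub_sq hX hid hconv hv hn)

theorem tendsto_E_average (hX : ∀ i, S.IsRandomVector (X i))
    (hid : ∀ i, IdentDistributed S S (X i) (X 0))
    (hconv : ∀ n, S.IsConvolution (X n) (fun ω => ∑ i ∈ Finset.range n, X i ω))
    {K : NNReal} {g : EuclideanSpace ℝ (Fin d) → ℝ} (hg : LipschitzWith K g) {M : ℝ}
    (hM : IsGreatest (g '' S.meanSet (X 0)) M) :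
    Tendsto (fun n : ℕ => S.E (fun ω => g ((n : ℝ)⁻¹ • ∑ i ∈ Finset.range n, X i ω)))
      atTop (𝓝 M) := by
  rw [tendsto_iff_norm_sub_tendsto_zero]
  refine squeeze_zero' (.of_forall fun _ => norm_nonneg _) ((eventually_ne_atTop 0).mono fun n hn =>
    abs_E_average_sub_le hX hid hconv hg hM hn) ?_
  simpa only [Real.sqrt_zero, mul_zero] using (tendsto_const_div_atTop_nhds_zero_nat
    (4 * S.E (fun ω => ‖X 0 ω‖ ^ 2))).sqrt.const_mul (K : ℝ)

end SumRange

/-! ### Test functions in the completion -/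

theorem abs_expect_comp_sub_le (hY : S.IsRandomVector Y) {φ g : EuclideanSpace ℝ (Fin d) → ℝ}
    (hg : LocLip g) {q : ℕ} {ε : ℝ} (hε : 0 ≤ ε) (hφg : ∀ x, |φ x - g x| ≤ ε * (1 + ‖x‖ ^ q)) :
    |S.expect (fun ω => φ (Y ω)) - S.E (fun ω => g (Y ω))| ≤
      ε * (1 + S.E (fun ω => ‖Y ω‖ ^ q)) := by
  have hpow := S.comp_vec_mem hY (LocLip.norm_pow q)
  rw [mul_one_add, ← S.E_const_add_mul hpow ε hε]
  exact S.abs_expect_sub_le (S.comp_vec_mem hY hg)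
    (S.add_mem (S.const_mem ε) (S.smul_mem ε hpow)) fun ω => by
      simpa only [mul_one_add] using hφg (Y ω)

theorem inCompletion_comp (hY : S.IsRandomVector Y) {φ : EuclideanSpace ℝ (Fin d) → ℝ}
    (hφ : Continuous φ) {q : ℕ}
    (hφq : φ =o[cocompact (EuclideanSpace ℝ (Fin d))] fun x => ‖x‖ ^ q) :
    S.InCompletion (fun ω => φ (Y ω)) := by
  intro ε hε
  have hpow := S.comp_vec_mem hY (LocLip.norm_pow q)
  have hpos : 0 < 1 + S.E (fun ω => ‖Y ω‖ ^ q) :=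
    add_pos_of_pos_of_nonneg one_pos (S.E_nonneg hpow fun ω => by positivity)
  set δ := ε / (1 + S.E (fun ω => ‖Y ω‖ ^ q)) with hδ
  have hδ0 : 0 < δ := div_pos hε hpos
  obtain ⟨K, g, hg, hφg⟩ := exists_lipschitzWith_abs_sub_le_of_isLittleO hφ hφq hδ0
  refine ⟨_, S.comp_vec_mem hY (.of_lipschitzWith hg), _,
    S.add_mem (S.const_mem δ) (S.smul_mem δ hpow),
    fun ω => by simpa only [mul_one_add] using hφg (Y ω), ?_⟩
  rw [S.E_const_add_mul hpow δ hδ0.le, ← mul_one_add, hδ, div_mul_cancel₀ _ hpos.ne']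

theorem tendsto_expect_comp {ι : Type*} {l : Filter ι} {Z : ι → Ω → EuclideanSpace ℝ (Fin d)}
    (hZ : ∀ i, S.IsRandomVector (Z i)) {q : ℕ} {B : ℝ}
    (hB : ∀ i, S.E (fun ω => ‖Z i ω‖ ^ q) ≤ B) {Ω' : Type*} [MeasurableSpace Ω']
    {S' : SublinearExpectation Ω'} {η : Ω' → EuclideanSpace ℝ (Fin d)} (hη : S'.IsRandomVector η)
    (hlim : ∀ (K : NNReal) (g : EuclideanSpace ℝ (Fin d) → ℝ), LipschitzWith K g →
      Tendsto (fun i => S.E (fun ω => g (Z i ω))) l (𝓝 (S'.E (fun ω => g (η ω)))))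
    {φ : EuclideanSpace ℝ (Fin d) → ℝ} (hφ : Continuous φ)
    (hφq : φ =o[cocompact (EuclideanSpace ℝ (Fin d))] fun x => ‖x‖ ^ q) :
    Tendsto (fun i => S.expect (fun ω => φ (Z i ω))) l (𝓝 (S'.expect (fun ω => φ (η ω)))) := by
  rw [Metric.tendsto_nhds]
  intro ε hε
  set B' := max B (S'.E (fun ω => ‖η ω‖ ^ q))
  have hB'_pos : 0 < 1 + B' := add_pos_of_pos_of_nonneg one_pos <|
    (S'.E_nonneg (S'.comp_vec_mem hη (LocLip.norm_pow q)) fun ω => by positivity).trans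
      (le_max_right _ _)
  set δ := ε / 3 / (1 + B')
  have hδ0 : 0 < δ := by positivity
  have hδB : δ * (1 + B') = ε / 3 := div_mul_cancel₀ _ hB'_pos.ne'
  obtain ⟨K, g, hg, hφg⟩ := exists_lipschitzWith_abs_sub_le_of_isLittleO hφ hφq hδ0
  have hgη : |S'.expect (fun ω => φ (η ω)) - S'.E (fun ω => g (η ω))| ≤ ε / 3 :=
    (abs_expect_comp_sub_le hη (.of_lipschitzWith hg) hδ0.le hφg).trans
      (hδB ▸ by gcongr; exact le_max_right _ _)
  filter_upwards [Metric.tendsto_nhds.1 (hlim K g hg) (ε / 3) (by positivity)] with i hi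
  have hgZ : |S.expect (fun ω => φ (Z i ω)) - S.E (fun ω => g (Z i ω))| ≤ ε / 3 :=
    (abs_expect_comp_sub_le (hZ i) (.of_lipschitzWith hg) hδ0.le hφg).trans
      (hδB ▸ by gcongr; exact (hB i).trans (le_max_left _ _))
  rw [Real.dist_eq, abs_lt] at hi ⊢
  rw [abs_le] at hgη hgZ
  constructor <;> linarith

/-! ### Maximal distributions -/

/-- The sublinear expectation of the maximal distribution on a nonempty compact set `Γ`: the
maximum over `Γ`, on the space of all continuous functions. -/
noncomputable def ofIsCompact {V : Type*} [TopologicalSpace V] [MeasurableSpace V]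
    [OpensMeasurableSpace V] {Γ : Set V} (hΓ : IsCompact Γ) (hne : Γ.Nonempty) :
    SublinearExpectation V where
  H := {f | Continuous f}
  E f := sSup (f '' Γ)
  measurable_of_mem _ hf := Continuous.measurable hf
  comp_mem _ _ hX _ hφ :=
    hφ.continuous.comp ((PiLp.continuous_toLp 2 _).comp (continuous_pi hX))
  mono X hX Y _ hYX := csSup_le (hne.image Y) <| Set.forall_mem_image.2 fun x hx =>
    (hYX x).trans (le_csSup (hΓ.image hX).bddAbove ⟨x, hx, rfl⟩)
  const c := by rw [hne.image_const, csSup_singleton]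
  subadd X hX Y hY := csSup_le (hne.image _) <| Set.forall_mem_image.2 fun x hx =>
    add_le_add (le_csSup (hΓ.image hX).bddAbove ⟨x, hx, rfl⟩)
      (le_csSup (hΓ.image hY).bddAbove ⟨x, hx, rfl⟩)
  posHom c hc X _ := by
    rw [← smul_eq_mul, ← Real.sSup_smul_of_nonneg hc, ← Set.image_smul, Set.image_image]
    rfl

theorem isGreatest_ofIsCompact_E {V : Type*} [TopologicalSpace V] [MeasurableSpace V]
    [OpensMeasurableSpace V] {Γ : Set V} (hΓ : IsCompact Γ) (hne : Γ.Nonempty) {f : V → ℝ}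
    (hf : Continuous f) : IsGreatest (f '' Γ) ((ofIsCompact hΓ hne).E f) :=
  (hΓ.image hf).isGreatest_sSup (hne.image f)

theorem exists_isMaximal_E_inner_eq (hY : S.IsRandomVector Y) :
    ∃ (S' : SublinearExpectation (EuclideanSpace ℝ (Fin d)))
      (η : EuclideanSpace ℝ (Fin d) → EuclideanSpace ℝ (Fin d)),
      S'.IsRandomVector η ∧ S'.IsMaximal η ∧
        ∀ p, S'.E (fun ω => inner ℝ p (η ω)) = S.E (fun ω => inner ℝ p (Y ω)) := by
  have hcpt := isCompact_meanSet hY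
  have hne := nonempty_meanSet hY
  refine ⟨ofIsCompact hcpt hne, id, fun i => EuclideanSpace.proj i |>.continuous,
    ⟨S.meanSet Y, hcpt.isBounded, isClosed_meanSet, convex_meanSet, fun φ hφ =>
      isGreatest_ofIsCompact_E hcpt hne hφ.continuous⟩, fun p => ?_⟩
  exact (isGreatest_ofIsCompact_E hcpt hne (by fun_prop)).unique (isGreatest_inner_meanSet hY p)

theorem IsMaximal.isGreatest_image_meanSet (hY : S.IsMaximal Y)
    {φ : EuclideanSpace ℝ (Fin d) → ℝ} (hφ : LocLip φ) :
    IsGreatest (φ '' S.meanSet Y) (S.E (fun ω => φ (Y ω))) := by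
  obtain ⟨Γ, -, hclosed, hconvex, hΓ⟩ := hY
  have hΓ_eq : Γ = S.meanSet Y :=
    eq_setOf_inner_le_of_isGreatest hconvex hclosed fun p => hΓ _ (LocLip.inner_right p)
  exact hΓ_eq ▸ hΓ φ hφ

end SublinearExpectation

open SublinearExpectation

theorem mainTheorem2_general {Ω : Type u} [MeasurableSpace Ω] (S : SublinearExpectation Ω) (d : ℕ)
    (X : ℕ → Ω → EuclideanSpace ℝ (Fin d))
    (hX : ∀ i, S.IsRandomVector (X i))
    (hid : ∀ i, IdentDistributed S S (X i) (X 0))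
    (hconv : ∀ n, S.IsConvolution (X n) (fun ω => ∑ i ∈ Finset.range n, X i ω)) :
    (∃ (S' : SublinearExpectation (EuclideanSpace ℝ (Fin d)))
        (η : EuclideanSpace ℝ (Fin d) → EuclideanSpace ℝ (Fin d)),
      S'.IsRandomVector η ∧ S'.IsMaximal η ∧
        ∀ p, S'.E (fun ω => inner ℝ p (η ω)) = S.E (fun ω => inner ℝ p (X 0 ω))) ∧
    ∀ (Ω' : Type v) [MeasurableSpace Ω'] (S' : SublinearExpectation Ω')
      (η : Ω' → EuclideanSpace ℝ (Fin d)),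
      S'.IsRandomVector η → S'.IsMaximal η →
      (∀ p, S'.E (fun ω => inner ℝ p (η ω)) = S.E (fun ω => inner ℝ p (X 0 ω))) →
      ∀ φ : EuclideanSpace ℝ (Fin d) → ℝ, Continuous φ → ∀ m : ℕ,
        (∃ C : ℝ, ∀ x, |φ x| ≤ C * (1 + ‖x‖ ^ m)) →
        (∀ n : ℕ, S.InCompletion (fun ω => φ ((n : ℝ)⁻¹ • ∑ i ∈ Finset.range n, X i ω))) ∧
        S'.InCompletion (fun ω => φ (η ω)) ∧
        Tendsto (fun n : ℕ => S.expect (fun ω => φ ((n : ℝ)⁻¹ • ∑ i ∈ Finset.range n, X i ω)))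
          atTop (𝓝 (S'.expect (fun ω => φ (η ω)))) := by
  refine ⟨exists_isMaximal_E_inner_eq (hX 0), fun Ω' _ S' η hη hmax hG φ hφ m ⟨C, hC⟩ => ?_⟩
  have hφ_littleO := isLittleO_cocompact_norm_pow_succ hC
  have havg (n : ℕ) : S.IsRandomVector (fun ω => (n : ℝ)⁻¹ • ∑ i ∈ Finset.range n, X i ω) :=
    (IsRandomVector.sum _ hX).const_smul _
  have hmeanSet : S'.meanSet η = S.meanSet (X 0) := by simp only [meanSet, hG]
  refine ⟨fun n => inCompletion_comp (havg n) hφ hφ_littleO, inCompletion_comp hη hφ hφ_littleO,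
    tendsto_expect_comp havg (fun n => S.E_norm_smul_sum_range_pow_le hX hid n m) hη
      (fun K g hg => ?_) hφ hφ_littleO⟩
  exact tendsto_E_average hX hid hconv hg
    (hmeanSet ▸ hmax.isGreatest_image_meanSet (.of_lipschitzWith hg))

theorem mainTheorem2 {Ω : Type u} [MeasurableSpace Ω] (S : SublinearExpectation Ω) (d : ℕ)
    (X : ℕ → Ω → EuclideanSpace ℝ (Fin d))
    (hX : ∀ i, S.IsRandomVector (X i))
    (hid : ∀ i, IdentDistributed S S (X i) (X 0))
    (hconv : S.IsConvolutionary X) :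
    (∃ (S' : SublinearExpectation (EuclideanSpace ℝ (Fin d)))
        (η : EuclideanSpace ℝ (Fin d) → EuclideanSpace ℝ (Fin d)),
      S'.IsRandomVector η ∧ S'.IsMaximal η ∧
        ∀ p, S'.E (fun ω => inner ℝ p (η ω)) = S.E (fun ω => inner ℝ p (X 0 ω))) ∧
    ∀ (Ω' : Type v) [MeasurableSpace Ω'] (S' : SublinearExpectation Ω')
      (η : Ω' → EuclideanSpace ℝ (Fin d)),
      S'.IsRandomVector η → S'.IsMaximal η →
      (∀ p, S'.E (fun ω => inner ℝ p (η ω)) = S.E (fun ω => inner ℝ p (X 0 ω))) →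
      ∀ φ : EuclideanSpace ℝ (Fin d) → ℝ, Continuous φ →
        (∃ C : ℝ, ∀ x, |φ x| ≤ C * (1 + ‖x‖)) →
        (∀ n : ℕ, S.InCompletion (fun ω => φ ((n : ℝ)⁻¹ • ∑ i ∈ Finset.range n, X i ω))) ∧
        S'.InCompletion (fun ω => φ (η ω)) ∧
        Tendsto (fun n : ℕ => S.expect (fun ω => φ ((n : ℝ)⁻¹ • ∑ i ∈ Finset.range n, X i ω)))
          atTop (𝓝 (S'.expect (fun ω => φ (η ω)))) := by
  obtain ⟨hex, hlim⟩ := mainTheorem2_general S d X hX hid hconv.isConvolution_sum_range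
  exact ⟨hex, fun Ω' _ S' η hη hmax hG φ hφ hC =>
    hlim Ω' S' η hη hmax hG φ hφ 1 (by simpa only [pow_one] using hC)⟩
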